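/- Let $m \ge 1$ and let $D=(D_{ij})$ be an $m\times m$ matrix of differences, i.e. a matrix of finite sets $D_{ij}\subset\mathbb{Z}$ with $D_{ji}=-D_{ij}=\{-d : d\in D_{ij}\}$ for all $i,j$. For $n\ge 1$ let $G_n$ be the $m$-block circulant graph with vertex set $\{0,\dots,m-1\}\times\{0,\dots,n-1\}$, in which $(i,u)$ and $(j,v)$ are adjacent if and only if $v-u$ is congruent modulo $n$ to some element of $D_{ij}$ (loops may occur). Let $\alpha(G_n)$ be the maximum size of an independent set, that is, of a set of vertices no two of which, equal or not, are adjacent (so it contains no vertex with a loop). Let $F=(f_{ij})$ be an $m\times m$ matrix of Laurent polynomials in $\mathbb{C}[z,z^{-1}]$ such that 1. $F$ is self-conjugate: for all $i,j$, if $f_{ij}(z)=\sum_k c_k z^k$, then $f_{ji}(z)=\sum_k \overline{c_k}\, z^{-k}$; 2. $F$ is non-degenerate: $\det F\neq 0$ in $\mathbb{C}[z,z^{-1}]$; 3. $F$ is majorized by $D$: for all $i,j$, $f_{ij}$ is of the form $f_{ij}(z)=\sum_{d\in D_{ij}} c_d z^d$. For $|z|=1$ the matrix $F(z)$ is Hermitian;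 let $n_+(z)$ and $n_-(z)$ be the numbers of its positive and negative eigenvalues, counted with multiplicity. Then the limit $$\alpha(D)=\lim_{n\to\infty}\frac{\alpha(G_n)}{nm}$$ exists, the functions $\theta\mapsto n_\pm(e^{i\theta})$ are integrable on $[0,2\pi]$, and with $$\rho_\pm(F)=\frac{1}{2\pi m}\int_0^{2\pi} n_\pm(e^{i\theta})\,d\theta$$ we have $$\alpha(D)\le \min\bigl(\rho_+(F),\rho_-(F)\bigr).$$ -/

import Mathlib

open scoped LaurentPolynomial Pointwise

namespace BlockCirculant

/-! ### The combinatorial side -/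

/-- An `m × m` matrix of finite integer sets with `D j i = - D i j` for all `i, j`. -/
def IsDifferenceMatrix {m : ℕ} (D : Fin m → Fin m → Finset ℤ) : Prop :=
  ∀ i j, D j i = -D i j

/-- Adjacency in the `m`-block circulant graph `G_n` on the vertices `(block, position)`:
`(i, u)` and `(j, v)` are adjacent iff `v - u` is congruent modulo `n` to an element of `D i j`.
Loops are allowed (for instance when `0 ∈ D i i`), so this is a relation and not a
`SimpleGraph`. -/
def Adj {m : ℕ} (D : Fin m → Fin m → Finset ℤ) (n : ℕ) (x y : Fin m × Fin n) : Prop :=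
  ∃ d ∈ D x.1 y.1, ((y.2 : ℕ) : ℤ) - ((x.2 : ℕ) : ℤ) ≡ d [ZMOD (n : ℤ)]

/-- For a matrix of differences, adjacency is symmetric. -/
theorem Adj.symm {m : ℕ} {D : Fin m → Fin m → Finset ℤ} (hD : IsDifferenceMatrix D) {n : ℕ}
    {x y : Fin m × Fin n} (h : Adj D n x y) : Adj D n y x := by
  obtain ⟨d, hd, h⟩ := h
  refine ⟨-d, ?_, ?_⟩
  · rw [hD x.1 y.1]
    simpa using hd
  · have := h.neg
    rwa [neg_sub] at this

/-- A set of vertices is independent if no two of its vertices, equal or not, are adjacent; in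
particular a vertex with a loop lies in no independent set. -/
def IsIndep {m : ℕ} (D : Fin m → Fin m → Finset ℤ) (n : ℕ) (S : Finset (Fin m × Fin n)) : Prop :=
  ∀ x ∈ S, ∀ y ∈ S, ¬ Adj D n x y

open Classical in
/-- `α(G_n)`: the size of a maximum independent set of `G_n`. -/
noncomputable def indepNum {m : ℕ} (D : Fin m → Fin m → Finset ℤ) (n : ℕ) : ℕ :=
  (Finset.univ.filter fun S : Finset (Fin m × Fin n) => IsIndep D n S).sup Finset.card

/-- `α_n = α(G_n) / (n m)`. -/
noncomputable def indepRatio {m : ℕ} (D : Fin m → Fin m → Finset ℤ) (n : ℕ) : ℝ :=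
  (indepNum D n : ℝ) / ((n : ℝ) * (m : ℝ))

/-- `α(D) = lim_{n → ∞} α(G_n) / (n m)`. -/
noncomputable def alpha {m : ℕ} (D : Fin m → Fin m → Finset ℤ) : ℝ :=
  Filter.limUnder Filter.atTop (indepRatio D)

/-! ### The analytic side -/

/-- The conjugate Laurent polynomial: `∑ c_k z^k ↦ ∑ conj(c_k) z^(-k)`. -/
noncomputable def conjLaurent (f : ℂ[T;T⁻¹]) : ℂ[T;T⁻¹] :=
  f.coeff.sum fun k c => LaurentPolynomial.C (starRingEnd ℂ c) * LaurentPolynomial.T (-k)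

/-- `F` is self-conjugate: `f_{ji}` is the conjugate of `f_{ij}` for all `i, j`. -/
def IsSelfConjugate {m : ℕ} (F : Matrix (Fin m) (Fin m) ℂ[T;T⁻¹]) : Prop :=
  ∀ i j, F j i = conjLaurent (F i j)

/-- `D` majorizes `F`: only the monomials `z^d` with `d ∈ D i j` may occur in `f_{ij}`. -/
def Majorizes {m : ℕ} (D : Fin m → Fin m → Finset ℤ) (F : Matrix (Fin m) (Fin m) ℂ[T;T⁻¹]) :
    Prop :=
  ∀ i j, (F i j).coeff.support ⊆ D i j

/-- The complex matrix `F(z)` for a point `z` of the unit circle. -/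
noncomputable def evalAt {m : ℕ} (F : Matrix (Fin m) (Fin m) ℂ[T;T⁻¹]) (z : Circle) :
    Matrix (Fin m) (Fin m) ℂ :=
  F.map (LaurentPolynomial.eval₂ (RingHom.id ℂ) (Circle.toUnits z))

open Classical in
/-- The number of positive real eigenvalues of `A`, i.e. of positive real roots of its
characteristic polynomial, counted with multiplicity. -/
noncomputable def numPos {m : ℕ} (A : Matrix (Fin m) (Fin m) ℂ) : ℕ :=
  A.charpoly.roots.countP fun t => t.im = 0 ∧ 0 < t.re

open Classical in
/-- The number of negative real eigenvalues of `A`, counted with multiplicity. -/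
noncomputable def numNeg {m : ℕ} (A : Matrix (Fin m) (Fin m) ℂ) : ℕ :=
  A.charpoly.roots.countP fun t => t.im = 0 ∧ t.re < 0

/-- `ρ₊(F)`: the average over the unit circle of the fraction of positive eigenvalues of `F(z)`. -/
noncomputable def rhoPos {m : ℕ} (F : Matrix (Fin m) (Fin m) ℂ[T;T⁻¹]) : ℝ :=
  1 / (2 * Real.pi * (m : ℝ)) *
    ∫ θ in (0 : ℝ)..(2 * Real.pi), (numPos (evalAt F (Circle.exp θ)) : ℝ)

/-- `ρ₋(F)`: the average over the unit circle of the fraction of negative eigenvalues of `F(z)`. -/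
noncomputable def rhoNeg {m : ℕ} (F : Matrix (Fin m) (Fin m) ℂ[T;T⁻¹]) : ℝ :=
  1 / (2 * Real.pi * (m : ℝ)) *
    ∫ θ in (0 : ℝ)..(2 * Real.pi), (numNeg (evalAt F (Circle.exp θ)) : ℝ)

end BlockCirculant

/-!
The limit exists by Fekete's lemma. Independent sets in the first `n` positions of the infinite
(non-cyclic) graph have a subadditive maximum size, and closing the segment up to a cycle costs at
most `m * r` vertices, where `r` bounds all differences (`tendsto_indepRatio`).

The upper bound is an inertia bound on every finite graph, averaged over a phase. Fix `n` and an
angle `θ`, let `z` run over the `n` points `exp (i (θ + 2 π j / n))` of the unit circle, and let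
`E z` be the Fourier transform at `z` restricted to vectors supported on an independent set `S`. By
orthogonality of characters, the `(p, q)` entry of `∑ z, (E z)ᴴ * F(z) * E z` only involves the
coefficients of `F` at exponents congruent modulo `n` to the difference of the positions of `p` and
`q`; as `D` majorizes `F`, these vanish for `p, q ∈ S`. If no `F(z)` is singular, a vector
supported on `S` all of whose Fourier components `E z *ᵥ x` lie in the span of the eigenvectors of
`F(z)` with eigenvalues of one sign must therefore vanish, and counting dimensions bounds `S.card`
by the total number of eigenvalues of the other sign (`card_le_sum_signedCount`,
`indepNum_le_sum_signedCount`).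

Since `det F ≠ 0`, the matrices `F(z)` are all nonsingular for almost every `θ`. Integrating the
bound over `θ ∈ [0, 2 π]` turns each of the `n` summands into the same integral by periodicity, so
`α(G_n) / (n m) ≤ ρ₊(F)` and `α(G_n) / (n m) ≤ ρ₋(F)` hold for every `n ≥ 1`
(`mul_indepNum_le_mul_integral`); no convergence of Riemann sums is needed. The eigenvalue counts
are measurable because they are pointwise limits of traces of polynomials in `F(z)`
(`measurable_signedCount`).
-/

/-! ### Independent sets without wraparound -/

namespace BlockCirculant

open Filter Topology

/-- Independence in the infinite graph on `Fin m × ℕ` in which `(i, u)` and `(j, v)` are adjacent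
iff `v - u ∈ D i j`. -/
def IsLinearIndep {m : ℕ} (D : Fin m → Fin m → Finset ℤ) (S : Finset (Fin m × ℕ)) : Prop :=
  ∀ x ∈ S, ∀ y ∈ S, (y.2 : ℤ) - (x.2 : ℤ) ∉ D x.1 y.1

open Classical in
/-- The maximum size of an independent set among the first `n` positions of the infinite graph. -/
noncomputable def linearIndepNum {m : ℕ} (D : Fin m → Fin m → Finset ℤ) (n : ℕ) : ℕ :=
  ((Finset.univ ×ˢ Finset.range n).powerset.filter (IsLinearIndep D)).sup Finset.card

variable {m : ℕ} {D : Fin m → Fin m → Finset ℤ}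

theorem IsLinearIndep.mono {S T : Finset (Fin m × ℕ)} (hT : IsLinearIndep D T) (h : S ⊆ T) :
    IsLinearIndep D S :=
  fun x hx y hy => hT x (h hx) y (h hy)

theorem IsLinearIndep.card_le_linearIndepNum {S : Finset (Fin m × ℕ)} (hS : IsLinearIndep D S)
    {n : ℕ} (hn : ∀ x ∈ S, x.2 < n) : S.card ≤ linearIndepNum D n := by
  classical
  refine Finset.le_sup (f := Finset.card) ?_
  simp only [Finset.mem_filter, Finset.mem_powerset]
  exact ⟨fun x hx => by simp [hn x hx], hS⟩

theorem exists_isLinearIndep (D : Fin m → Fin m → Finset ℤ) (n : ℕ) :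
    ∃ S : Finset (Fin m × ℕ), IsLinearIndep D S ∧ (∀ x ∈ S, x.2 < n) ∧
      S.card = linearIndepNum D n := by
  classical
  obtain ⟨S, hS, h⟩ := Finset.exists_mem_eq_sup
    ((Finset.univ ×ˢ Finset.range n).powerset.filter (IsLinearIndep D))
    ⟨∅, by simp [IsLinearIndep]⟩ Finset.card
  simp only [Finset.mem_filter, Finset.mem_powerset] at hS
  refine ⟨S, hS.2, fun x hx => ?_, h.symm⟩
  simpa using hS.1 hx

theorem IsIndep.card_le_indepNum {n : ℕ} {S : Finset (Fin m × Fin n)} (hS : IsIndep D n S) :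
    S.card ≤ indepNum D n := by
  classical
  exact Finset.le_sup (f := Finset.card) (by simpa using hS)

theorem exists_isIndep (D : Fin m → Fin m → Finset ℤ) (n : ℕ) :
    ∃ S : Finset (Fin m × Fin n), IsIndep D n S ∧ S.card = indepNum D n := by
  classical
  obtain ⟨S, hS, h⟩ := Finset.exists_mem_eq_sup
    (Finset.univ.filter fun S : Finset (Fin m × Fin n) => IsIndep D n S)
    ⟨∅, by simp [IsIndep]⟩ Finset.card
  simp only [Finset.mem_filter, Finset.mem_univ, true_and] at hS
  exact ⟨S, hS, h.symm⟩

/-- Cutting a segment in two splits an independent set into two independent sets. -/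
theorem subadditive_linearIndepNum (D : Fin m → Fin m → Finset ℤ) :
    Subadditive fun n => (linearIndepNum D n : ℝ) := by
  classical
  intro a b
  obtain ⟨S, hS, hlt, hcard⟩ := exists_isLinearIndep D (a + b)
  have h1 : (S.filter fun x => x.2 < a).card ≤ linearIndepNum D a :=
    (hS.mono (Finset.filter_subset _ _)).card_le_linearIndepNum
      fun x hx => (Finset.mem_filter.1 hx).2
  let T : Finset (Fin m × ℕ) := S.filter fun x => ¬ x.2 < a
  have hT : ∀ x ∈ T, x ∈ S ∧ a ≤ x.2 := fun x hx => by simpa [T] using hx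
  let g : Fin m × ℕ → Fin m × ℕ := fun x => (x.1, x.2 - a)
  have hinj : Set.InjOn g T := by
    intro x hx y hy hxy
    have hx' := (hT x hx).2
    have hy' := (hT y hy).2
    simp only [g, Prod.mk.injEq] at hxy
    exact Prod.ext hxy.1 (by omega)
  have h2 : T.card ≤ linearIndepNum D b := by
    rw [← Finset.card_image_of_injOn hinj]
    refine IsLinearIndep.card_le_linearIndepNum ?_ ?_
    · intro x hx y hy
      obtain ⟨x, hxT, rfl⟩ := Finset.mem_image.1 hx
      obtain ⟨y, hyT, rfl⟩ := Finset.mem_image.1 hy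
      have := hS x (hT x hxT).1 y (hT y hyT).1
      simpa [g, Nat.cast_sub (hT x hxT).2, Nat.cast_sub (hT y hyT).2] using this
    · intro x hx
      obtain ⟨x, hxT, rfl⟩ := Finset.mem_image.1 hx
      have := hlt x (hT x hxT).1
      have := (hT x hxT).2
      simp only [g]
      omega
  have h3 := Finset.card_filter_add_card_filter_not (s := S) (fun x => x.2 < a)
  have : linearIndepNum D (a + b) ≤ linearIndepNum D a + linearIndepNum D b := by
    rw [← hcard, ← h3]
    exact add_le_add h1 h2
  beta_reduce
  exact_mod_cast this

theorem indepNum_le_linearIndepNum (D : Fin m → Fin m → Finset ℤ) (n : ℕ) :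
    indepNum D n ≤ linearIndepNum D n := by
  classical
  obtain ⟨S, hS, hcard⟩ := exists_isIndep D n
  let g : Fin m × Fin n → Fin m × ℕ := fun x => (x.1, x.2)
  have hinj : Function.Injective g := by
    intro x y hxy
    simp only [g, Prod.mk.injEq] at hxy
    exact Prod.ext hxy.1 (Fin.ext hxy.2)
  rw [← hcard, ← Finset.card_image_of_injective S hinj]
  refine IsLinearIndep.card_le_linearIndepNum ?_ ?_
  · intro x hx y hy hd
    obtain ⟨x, hxS, rfl⟩ := Finset.mem_image.1 hx
    obtain ⟨y, hyS, rfl⟩ := Finset.mem_image.1 hy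
    exact hS x hxS y hyS ⟨_, hd, Int.ModEq.refl _⟩
  · intro x hx
    obtain ⟨x, hx, rfl⟩ := Finset.mem_image.1 hx
    exact x.2.isLt

/-- Discarding the last `r` positions, where `r` bounds all differences, prevents adjacency
around the end of the cycle. -/
theorem linearIndepNum_le_indepNum_add {r : ℕ} (hr : ∀ i j, ∀ d ∈ D i j, |d| ≤ r) (n : ℕ) :
    linearIndepNum D n ≤ indepNum D n + m * r := by
  classical
  obtain ⟨S, hS, hlt, hcard⟩ := exists_isLinearIndep D n
  let T : Finset (Fin m × Fin n) := Finset.univ.filter fun x => (x.1, (x.2 : ℕ)) ∈ S ∧ x.2 + r < n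
  have hT : IsIndep D n T := by
    rintro x hx y hy ⟨d, hd, hmod⟩
    simp only [T, Finset.mem_filter, Finset.mem_univ, true_and] at hx hy
    have hd' := abs_le.1 (hr _ _ d hd)
    have hdvd := hmod.symm.dvd
    have hzero : ((y.2 : ℕ) : ℤ) - ((x.2 : ℕ) : ℤ) - d = 0 := by
      refine Int.eq_zero_of_abs_lt_dvd hdvd ?_
      rw [abs_lt]
      constructor <;> omega
    have hmem := hS _ hx.1 _ hy.1
    rw [sub_eq_zero.1 hzero] at hmem
    exact hmem hd
  have hcover : S ⊆ T.image (fun x => (x.1, (x.2 : ℕ))) ∪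
      Finset.univ ×ˢ Finset.Ico (n - r) n := by
    intro x hx
    have hxn := hlt x hx
    rw [Finset.mem_union]
    by_cases h : x.2 + r < n
    · exact Or.inl (Finset.mem_image.2 ⟨(x.1, ⟨x.2, hxn⟩), by simp [T, hx, h], rfl⟩)
    · right
      simp only [Finset.mem_product, Finset.mem_univ, Finset.mem_Ico, true_and]
      omega
  calc linearIndepNum D n = S.card := hcard.symm
    _ ≤ _ := Finset.card_le_card hcover
    _ ≤ _ := Finset.card_union_le _ _
    _ ≤ indepNum D n + m * r := by
      refine add_le_add (Finset.card_image_le.trans hT.card_le_indepNum) ?_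
      rw [Finset.card_product, Finset.card_univ, Fintype.card_fin, Nat.card_Ico]
      exact Nat.mul_le_mul_left _ (by omega)

theorem exists_abs_le (D : Fin m → Fin m → Finset ℤ) :
    ∃ r : ℕ, ∀ i j, ∀ d ∈ D i j, |d| ≤ r := by
  refine ⟨∑ i, ∑ j, ∑ d ∈ D i j, d.natAbs, fun i j d hd => ?_⟩
  rw [Int.abs_eq_natAbs]
  have h1 : d.natAbs ≤ ∑ d ∈ D i j, d.natAbs :=
    Finset.single_le_sum (f := Int.natAbs) (fun _ _ => Nat.zero_le _) hd
  have h2 : ∑ d ∈ D i j, d.natAbs ≤ ∑ j, ∑ d ∈ D i j, d.natAbs :=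
    Finset.single_le_sum (f := fun j => ∑ d ∈ D i j, d.natAbs)
      (fun _ _ => Nat.zero_le _) (Finset.mem_univ j)
  have h3 : ∑ j, ∑ d ∈ D i j, d.natAbs ≤ ∑ i, ∑ j, ∑ d ∈ D i j, d.natAbs :=
    Finset.single_le_sum (f := fun i => ∑ j, ∑ d ∈ D i j, d.natAbs)
      (fun _ _ => Nat.zero_le _) (Finset.mem_univ i)
  exact_mod_cast h1.trans (h2.trans h3)

/-- The independence ratios converge: they differ by `O(1 / n)` from the ratios of a subadditive
sequence, to which Fekete's lemma applies. -/
theorem tendsto_indepRatio (D : Fin m → Fin m → Finset ℤ) :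
    Tendsto (indepRatio D) atTop (𝓝 (alpha D)) := by
  obtain ⟨r, hr⟩ := exists_abs_le D
  have hsub := subadditive_linearIndepNum D
  have hlim := hsub.tendsto_lim ⟨0, by rintro _ ⟨n, rfl⟩; positivity⟩
  have hupper := hlim.div_const (m : ℝ)
  have hlower := (hlim.sub
    (tendsto_const_div_atTop_nhds_zero_nat ((m : ℝ) * r))).div_const (m : ℝ)
  rw [sub_zero] at hlower
  have h : Tendsto (indepRatio D) atTop (𝓝 (hsub.lim / m)) := by
    refine tendsto_of_tendsto_of_tendsto_of_le_of_le hlower hupper (fun n => ?_) fun n => ?_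
    · have h1 : (linearIndepNum D n : ℝ) ≤ indepNum D n + m * r := by
        exact_mod_cast linearIndepNum_le_indepNum_add hr n
      simp only [indepRatio]
      rw [← sub_div, ← div_div]
      gcongr
      linarith
    · simp only [indepRatio]
      rw [← div_div]
      gcongr
      exact indepNum_le_linearIndepNum D n
  rw [alpha, h.limUnder_eq]
  exact h

end BlockCirculant

/-! ### Counting eigenvalues of one sign -/

namespace BlockCirculant

open Matrix Polynomial Filter Topology

open Classical in
/-- The number of eigenvalues of `A`, with multiplicity, whose real part has the sign of `s`.
Taking `s = 1` and `s = -1` treats positive and negative eigenvalues uniformly. -/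
noncomputable def signedCount {m : ℕ} (s : ℝ) (A : Matrix (Fin m) (Fin m) ℂ) : ℕ :=
  A.charpoly.roots.countP fun t => 0 < s * t.re

theorem signedCount_eq_card {m : ℕ} (s : ℝ) {A : Matrix (Fin m) (Fin m) ℂ}
    (hA : A.IsHermitian) :
    signedCount s A = Fintype.card {i // 0 < s * hA.eigenvalues i} := by
  classical
  rw [signedCount, hA.roots_charpoly_eq_eigenvalues, Multiset.countP_map, Fintype.card_subtype]
  simp [Finset.card_def]

theorem numPos_eq_signedCount {m : ℕ} {A : Matrix (Fin m) (Fin m) ℂ} (hA : A.IsHermitian) :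
    numPos A = signedCount 1 A := by
  classical
  rw [numPos, signedCount, hA.roots_charpoly_eq_eigenvalues, Multiset.countP_map,
    Multiset.countP_map]
  simp

theorem numNeg_eq_signedCount {m : ℕ} {A : Matrix (Fin m) (Fin m) ℂ} (hA : A.IsHermitian) :
    numNeg A = signedCount (-1) A := by
  classical
  rw [numNeg, signedCount, hA.roots_charpoly_eq_eigenvalues, Multiset.countP_map,
    Multiset.countP_map]
  simp

theorem signedCount_le {m : ℕ} (s : ℝ) {A : Matrix (Fin m) (Fin m) ℂ} (hA : A.IsHermitian) :
    signedCount s A ≤ m := by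
  classical
  rw [signedCount_eq_card s hA]
  simpa using Fintype.card_subtype_le (fun i => 0 < s * hA.eigenvalues i)

/-- The quadratic form of a Hermitian matrix in the coordinates of an orthonormal eigenbasis. -/
theorem star_dotProduct_mulVec_eq_sum_eigenvalues {ι : Type*} [Fintype ι] [DecidableEq ι]
    {A : Matrix ι ι ℂ} (hA : A.IsHermitian) (v : ι → ℂ) :
    star v ⬝ᵥ (A *ᵥ v) =
      ((∑ i, hA.eigenvalues i *
        ‖((hA.eigenvectorUnitary : Matrix ι ι ℂ)ᴴ *ᵥ v) i‖ ^ 2 : ℝ) : ℂ) := by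
  set U : Matrix ι ι ℂ := ↑hA.eigenvectorUnitary with hU
  have hspec : A = U * diagonal (RCLike.ofReal ∘ hA.eigenvalues) * Uᴴ := by
    conv_lhs => rw [hA.spectral_theorem, Unitary.conjStarAlgAut_apply]
    rfl
  conv_lhs => rw [hspec]
  rw [← mulVec_mulVec, ← mulVec_mulVec, dotProduct_mulVec,
    show star v ᵥ* U = star (Uᴴ *ᵥ v) by rw [star_mulVec, conjTranspose_conjTranspose]]
  simp only [dotProduct, mulVec_diagonal, Pi.star_apply, Complex.ofReal_sum, Complex.ofReal_mul,
    Complex.ofReal_pow, Function.comp_apply]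
  refine Finset.sum_congr rfl fun i _ => ?_
  rw [← Complex.conj_mul']
  simp only [RCLike.star_def, Complex.coe_algebraMap]
  ring

/-- **Inertia bound** for a family of invertible Hermitian matrices: if the sum of the quadratic
forms `A j`, pulled back along jointly injective maps `E j`, vanishes, then the dimension of the
source is at most the total number of eigenvalues of any one sign. Otherwise some nonzero vector
would have, for every `j`, an image spanned by eigenvectors of the opposite sign, on which the sum
of the forms is definite. -/
theorem card_le_sum_signedCount {m : ℕ} {J σ : Type*} [Fintype J] [Fintype σ]
    {s : ℝ} (hs : s ≠ 0) (A : J → Matrix (Fin m) (Fin m) ℂ) (hA : ∀ j, (A j).IsHermitian)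
    (hdet : ∀ j, (A j).det ≠ 0) (E : J → Matrix (Fin m) σ ℂ)
    (hE : ∀ x : σ → ℂ, (∀ j, E j *ᵥ x = 0) → x = 0)
    (hzero : ∑ j, (E j)ᴴ * A j * E j = 0) :
    Fintype.card σ ≤ ∑ j, signedCount s (A j) := by
  classical
  let U : J → Matrix (Fin m) (Fin m) ℂ := fun j => (hA j).eigenvectorUnitary
  have hUU : ∀ j, U j * (U j)ᴴ = 1 := fun j => Unitary.coe_mul_star_self (hA j).eigenvectorUnitary
  let I : J → Type := fun j => {i : Fin m // 0 < s * (hA j).eigenvalues i}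
  let Φ : (σ → ℂ) →ₗ[ℂ] (Σ j, I j) → ℂ :=
    LinearMap.pi fun p => (LinearMap.proj p.2.1).comp ((U p.1)ᴴ * E p.1).mulVecLin
  have hΦ : Function.Injective Φ := by
    rw [← LinearMap.ker_eq_bot, LinearMap.ker_eq_bot']
    intro x hx
    let y : J → Fin m → ℂ := fun j => (U j)ᴴ *ᵥ (E j *ᵥ x)
    have hy : ∀ j i, 0 < s * (hA j).eigenvalues i → y j i = 0 := by
      intro j i hi
      have := congrFun hx ⟨j, i, hi⟩
      simpa [Φ, y, mulVec_mulVec] using this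
    have hsum : ∑ j, ∑ i, (hA j).eigenvalues i * ‖y j i‖ ^ 2 = 0 := by
      have h0 : star x ⬝ᵥ ((∑ j, (E j)ᴴ * A j * E j) *ᵥ x) = 0 := by rw [hzero]; simp
      rw [sum_mulVec, dotProduct_sum] at h0
      have hterm : ∀ j, star x ⬝ᵥ (((E j)ᴴ * A j * E j) *ᵥ x) =
          ((∑ i, (hA j).eigenvalues i * ‖y j i‖ ^ 2 : ℝ) : ℂ) := by
        intro j
        rw [← star_dotProduct_mulVec_eq_sum_eigenvalues (hA j), ← mulVec_mulVec, ← mulVec_mulVec,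
          dotProduct_mulVec, ← star_mulVec]
      rw [Finset.sum_congr rfl fun j _ => hterm j, ← Complex.ofReal_sum] at h0
      exact_mod_cast h0
    have hnonneg : ∀ j i, 0 ≤ -(s * ((hA j).eigenvalues i * ‖y j i‖ ^ 2)) := by
      intro j i
      rcases lt_or_ge 0 (s * (hA j).eigenvalues i) with h | h
      · simp [hy j i h]
      · rw [← mul_assoc, ← neg_mul]
        exact mul_nonneg (by linarith) (sq_nonneg _)
    have hall : ∑ j, ∑ i, -(s * ((hA j).eigenvalues i * ‖y j i‖ ^ 2)) = 0 := by
      simp only [Finset.sum_neg_distrib, ← Finset.mul_sum, hsum, mul_zero, neg_zero]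
    have hy0 : ∀ j, y j = 0 := by
      intro j
      funext i
      have h1 := (Finset.sum_eq_zero_iff_of_nonneg
        fun j _ => Finset.sum_nonneg fun i _ => hnonneg j i).1 hall j (Finset.mem_univ _)
      have h2 := (Finset.sum_eq_zero_iff_of_nonneg
        fun i _ => hnonneg j i).1 h1 i (Finset.mem_univ _)
      have hne : (hA j).eigenvalues i ≠ 0 := by
        intro h
        apply hdet j
        rw [(hA j).det_eq_prod_eigenvalues]
        exact Finset.prod_eq_zero (Finset.mem_univ i) (by simp [h])
      simpa [hs, hne] using h2
    apply hE
    intro j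
    have := congrArg (fun w => U j *ᵥ w) (hy0 j)
    simpa [y, mulVec_mulVec, ← Matrix.mul_assoc, hUU] using this
  have := LinearMap.finrank_le_finrank_of_injective hΦ
  rw [Module.finrank_fintype_fun_eq_card, Module.finrank_fintype_fun_eq_card,
    Fintype.card_sigma] at this
  simpa [I, ← signedCount_eq_card s (hA _)] using this

/-! ### Measurability of eigenvalue counts -/

/-- The trace of a polynomial in a Hermitian matrix is the sum of its values at the eigenvalues. -/
theorem trace_aeval_eq_sum_eigenvalues {ι : Type*} [Fintype ι] [DecidableEq ι]
    {A : Matrix ι ι ℂ} (hA : A.IsHermitian) (p : ℝ[X]) :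
    (aeval A p).trace = ((∑ i, p.eval (hA.eigenvalues i) : ℝ) : ℂ) := by
  set U : Matrix ι ι ℂ := ↑hA.eigenvectorUnitary with hU
  have hUU : Uᴴ * U = 1 := Unitary.coe_star_mul_self hA.eigenvectorUnitary
  have hspec : A = U * diagonal (fun i => (hA.eigenvalues i : ℂ)) * Uᴴ := by
    conv_lhs => rw [hA.spectral_theorem, Unitary.conjStarAlgAut_apply]
    rfl
  have hpow : ∀ k : ℕ, A ^ k = U * diagonal (fun i => (hA.eigenvalues i : ℂ) ^ k) * Uᴴ := by
    intro k
    induction k with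
    | zero =>
      have h : U * Uᴴ = 1 := Unitary.coe_mul_star_self hA.eigenvectorUnitary
      simp [h]
    | succ k ih =>
      rw [pow_succ, ih]
      conv_lhs => enter [2]; rw [hspec]
      calc _ = U * diagonal (fun i => (hA.eigenvalues i : ℂ) ^ k) * (Uᴴ * U) *
            diagonal (fun i => (hA.eigenvalues i : ℂ)) * Uᴴ := by simp only [Matrix.mul_assoc]
        _ = _ := by
          rw [hUU, Matrix.mul_one, Matrix.mul_assoc U, diagonal_mul_diagonal]
          simp only [pow_succ]
  have htr : ∀ k : ℕ, (A ^ k).trace = ∑ i, (hA.eigenvalues i : ℂ) ^ k := by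
    intro k
    rw [hpow, trace_mul_comm, ← Matrix.mul_assoc, hUU, Matrix.one_mul, trace_diagonal]
  rw [aeval_eq_sum_range, trace_sum]
  simp only [trace_smul, htr, eval_eq_sum_range]
  push_cast
  rw [Finset.sum_comm]
  refine Finset.sum_congr rfl fun k _ => ?_
  rw [Finset.smul_sum]
  simp

/-- The indicator of a half-line is a pointwise limit of polynomials on the whole real line. -/
theorem exists_polynomial_tendsto_ite (s : ℝ) :
    ∃ p : ℕ → ℝ[X], ∀ x : ℝ,
      Tendsto (fun k => (p k).eval x) atTop (𝓝 (if 0 < s * x then 1 else 0)) := by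
  -- The `k`-th polynomial is close, on `[-k, k]`, to a ramp of slope `k * s` cut off at `0` and `1`.
  let f : ℕ → ℝ → ℝ := fun k x => min 1 (max 0 (k * (s * x)))
  have hf : ∀ k, Continuous (f k) := fun k => by fun_prop
  choose p hp using fun k : ℕ => exists_polynomial_near_of_continuousOn (-(k : ℝ)) k (f k)
    (hf k).continuousOn (1 / ((k : ℝ) + 1)) (by positivity)
  refine ⟨p, fun x => ?_⟩
  have hlim : Tendsto (fun k => f k x) atTop (𝓝 (if 0 < s * x then 1 else 0)) := by
    split_ifs with h
    · refine tendsto_const_nhds.congr' ?_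
      obtain ⟨N, hN⟩ := exists_nat_gt (1 / (s * x))
      filter_upwards [eventually_ge_atTop N] with k hk
      have h1 : 1 < (k : ℝ) * (s * x) := by
        rw [div_lt_iff₀ h] at hN
        have : (N : ℝ) ≤ k := by exact_mod_cast hk
        nlinarith
      simp only [f]
      rw [max_eq_right (by linarith), min_eq_left h1.le]
    · refine tendsto_const_nhds.congr' (Eventually.of_forall fun k => ?_)
      have h1 : (k : ℝ) * (s * x) ≤ 0 :=
        mul_nonpos_of_nonneg_of_nonpos (Nat.cast_nonneg k) (not_lt.1 h)
      simp only [f]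
      rw [max_eq_left h1, min_eq_right zero_le_one]
  have hdiff : Tendsto (fun k => (p k).eval x - f k x) atTop (𝓝 0) := by
    refine squeeze_zero_norm' ?_ tendsto_one_div_add_atTop_nhds_zero_nat
    obtain ⟨N, hN⟩ := exists_nat_gt |x|
    filter_upwards [eventually_ge_atTop N] with k hk
    have hk' : (N : ℝ) ≤ k := by exact_mod_cast hk
    exact (hp k x (abs_le.1 (hN.le.trans hk'))).le
  simpa using hdiff.add hlim

theorem measurable_signedCount {m : ℕ} (s : ℝ) {A : ℝ → Matrix (Fin m) (Fin m) ℂ}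
    (hA : ∀ θ, (A θ).IsHermitian) (hc : Continuous A) :
    Measurable fun θ => (signedCount s (A θ) : ℝ) := by
  classical
  obtain ⟨p, hp⟩ := exists_polynomial_tendsto_ite s
  refine measurable_of_tendsto_metrizable (f := fun k θ => ((aeval (A θ) (p k)).trace).re)
    (fun k => ?_) (tendsto_pi_nhds.2 fun θ => ?_)
  · have h1 : Continuous fun θ => aeval (A θ) (p k) := (p k).continuous_aeval.comp hc
    exact (Complex.continuous_re.comp h1.matrix_trace).measurable
  · simp only [trace_aeval_eq_sum_eigenvalues (hA θ), Complex.ofReal_re]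
    have : (signedCount s (A θ) : ℝ) =
        ∑ i, if 0 < s * (hA θ).eigenvalues i then (1 : ℝ) else 0 := by
      rw [signedCount_eq_card s (hA θ), Fintype.card_subtype, Finset.sum_boole]
    rw [this]
    exact tendsto_finsetSum _ fun i _ => hp _

end BlockCirculant

/-! ### The Hermitian symbol on the unit circle -/

namespace BlockCirculant

open Matrix Filter Topology

variable {m : ℕ}

theorem eval₂_toUnits_eq_sum (f : ℂ[T;T⁻¹]) (z : Circle) :
    LaurentPolynomial.eval₂ (RingHom.id ℂ) (Circle.toUnits z) f =
      f.coeff.sum fun k c => c * (z : ℂ) ^ k := by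
  conv_lhs => rw [← AddMonoidAlgebra.sum_coeff_single f]
  rw [map_finsuppSum]
  simp only [LaurentPolynomial.single_eq_C_mul_T, LaurentPolynomial.eval₂_C_mul_T]
  simp

theorem conj_circle_zpow (z : Circle) (k : ℤ) :
    (starRingEnd ℂ) ((z : ℂ) ^ k) = (z : ℂ) ^ (-k) := by
  rw [map_zpow₀, ← Circle.coe_inv_eq_conj, Circle.coe_inv, _root_.inv_zpow, _root_.zpow_neg]

theorem eval₂_conjLaurent (f : ℂ[T;T⁻¹]) (z : Circle) :
    LaurentPolynomial.eval₂ (RingHom.id ℂ) (Circle.toUnits z) (conjLaurent f) =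
      starRingEnd ℂ (LaurentPolynomial.eval₂ (RingHom.id ℂ) (Circle.toUnits z) f) := by
  rw [eval₂_toUnits_eq_sum f, conjLaurent, map_finsuppSum, map_finsuppSum]
  simp only [map_mul, conj_circle_zpow]
  simp

theorem isHermitian_evalAt {F : Matrix (Fin m) (Fin m) ℂ[T;T⁻¹]} (hF : IsSelfConjugate F)
    (z : Circle) : (evalAt F z).IsHermitian := by
  ext i j
  simp only [conjTranspose_apply, evalAt, map_apply, RCLike.star_def]
  rw [hF i j, eval₂_conjLaurent, Complex.conj_conj]

theorem continuous_evalAt_exp (F : Matrix (Fin m) (Fin m) ℂ[T;T⁻¹]) :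
    Continuous fun θ : ℝ => evalAt F (Circle.exp θ) := by
  refine continuous_matrix fun i j => ?_
  simp only [evalAt, map_apply, eval₂_toUnits_eq_sum, Finsupp.sum]
  refine continuous_finsetSum _ fun k _ => continuous_const.mul ?_
  exact (continuous_subtype_val.comp Circle.exp.continuous).zpow₀ k
    fun θ => Or.inl (Circle.coe_ne_zero _)

/-- A nonzero Laurent polynomial vanishes at only finitely many points of the unit circle. -/
theorem finite_setOf_eval₂_eq_zero {f : ℂ[T;T⁻¹]} (hf : f ≠ 0) :
    {z : Circle | LaurentPolynomial.eval₂ (RingHom.id ℂ) (Circle.toUnits z) f = 0}.Finite := by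
  obtain ⟨n, p, hp⟩ := f.exists_T_pow
  have hp0 : p ≠ 0 := by
    rintro rfl
    rw [map_zero] at hp
    exact hf ((LaurentPolynomial.isUnit_T (R := ℂ) n).mul_left_eq_zero.1 hp.symm)
  refine ((p.rootSet_finite ℂ).preimage Circle.coe_injective.injOn).subset fun z hz => ?_
  have hz0 : LaurentPolynomial.eval₂ (RingHom.id ℂ) (Circle.toUnits z) f = 0 := hz
  have h := congrArg (LaurentPolynomial.eval₂ (RingHom.id ℂ) (Circle.toUnits z)) hp
  rw [map_mul, hz0, zero_mul, LaurentPolynomial.eval₂_toLaurent] at h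
  rw [Set.mem_preimage, Polynomial.mem_rootSet]
  exact ⟨hp0, h⟩

theorem countable_preimage_circle_exp {s : Set Circle} (hs : s.Finite) :
    (Circle.exp ⁻¹' s).Countable := by
  rw [← Set.biUnion_preimage_singleton]
  refine hs.countable.biUnion fun z _ => ?_
  obtain ⟨θ₀, rfl⟩ := Circle.exp_surjective z
  refine (Set.countable_range fun k : ℤ => θ₀ + k * (2 * Real.pi)).mono fun θ hθ => ?_
  obtain ⟨k, hk⟩ := Circle.exp_eq_exp.1 hθ
  exact ⟨k, hk.symm⟩

theorem ae_det_evalAt_exp_ne_zero {F : Matrix (Fin m) (Fin m) ℂ[T;T⁻¹]} (hdet : F.det ≠ 0)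
    (c : ℝ) : ∀ᵐ θ : ℝ, (evalAt F (Circle.exp (θ + c))).det ≠ 0 := by
  have hcount := (countable_preimage_circle_exp (finite_setOf_eval₂_eq_zero hdet)).preimage
    (add_left_injective c)
  filter_upwards [hcount.ae_notMem MeasureTheory.volume] with θ hθ h
  apply hθ
  rw [Set.mem_preimage, Set.mem_preimage, Set.mem_ofPred_eq, RingHom.map_det]
  exact h

/-! ### Fourier nodes and the finite bound -/

/-- The `n` equally spaced points of the unit circle, starting at angle `θ`. -/
noncomputable def fourierNode (n : ℕ) (θ : ℝ) (j : Fin n) : Circle :=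
  Circle.exp (θ + 2 * Real.pi * j / n)

/-- Orthogonality of characters. -/
theorem sum_fourierNode_zpow_eq_zero {n : ℕ} (θ : ℝ) {k : ℤ} (hk : ¬ (n : ℤ) ∣ k) :
    ∑ j : Fin n, (fourierNode n θ j : ℂ) ^ k = 0 := by
  rcases Nat.eq_zero_or_pos n with rfl | hn
  · simp
  have hn' : (n : ℝ) ≠ 0 := by positivity
  let ζ : Circle := Circle.exp (k * (2 * Real.pi / n))
  have hζn : ζ ^ n = 1 := by
    rw [← Circle.exp_natCast_mul, Circle.exp_eq_one]
    exact ⟨k, by field_simp⟩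
  have hζ : ζ ≠ 1 := by
    intro h
    obtain ⟨l, hl⟩ := Circle.exp_eq_one.1 h
    have hpi := Real.pi_pos.ne'
    have : (k : ℝ) = n * l := by
      field_simp at hl
      linarith
    exact hk ⟨l, by exact_mod_cast this⟩
  have hterm : ∀ j : Fin n, (fourierNode n θ j : ℂ) ^ k =
      (Circle.exp θ : ℂ) ^ k * (ζ : ℂ) ^ (j : ℕ) := by
    intro j
    rw [← Circle.coe_zpow, ← Circle.coe_zpow, ← Circle.coe_pow, ← Circle.coe_mul]
    congr 1
    rw [fourierNode, ← Circle.exp_intCast_mul, ← Circle.exp_intCast_mul, ← Circle.exp_natCast_mul,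
      ← Circle.exp_add]
    congr 1
    field_simp
  have hgeom : ∑ j : Fin n, (ζ : ℂ) ^ (j : ℕ) = 0 := by
    rw [Fin.sum_univ_eq_sum_range (fun j => (ζ : ℂ) ^ j)]
    have h1 := geom_sum_mul (ζ : ℂ) n
    rw [← Circle.coe_pow, hζn, Circle.coe_one, sub_self] at h1
    refine (mul_eq_zero.1 h1).resolve_right (sub_ne_zero.2 fun h => hζ ?_)
    exact Circle.ext (by simpa using h)
  rw [Finset.sum_congr rfl fun j _ => hterm j, ← Finset.mul_sum, hgeom, mul_zero]

/-- The matrix of the discrete Fourier transform at `z`, block by block, for vectors supported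
on a vertex set `S`. -/
noncomputable def fourierMatrix {n : ℕ} (S : Finset (Fin m × Fin n)) (z : Circle) :
    Matrix (Fin m) S ℂ :=
  Matrix.of fun i p => if i = p.1.1 then (z : ℂ) ^ (-((p.1.2 : ℕ) : ℤ)) else 0

theorem fourierMatrix_conj_apply {n : ℕ} (S : Finset (Fin m × Fin n)) (z : Circle)
    (A : Matrix (Fin m) (Fin m) ℂ) (p q : S) :
    ((fourierMatrix S z)ᴴ * A * fourierMatrix S z) p q =
      A p.1.1 q.1.1 * (z : ℂ) ^ (((p.1.2 : ℕ) : ℤ) - ((q.1.2 : ℕ) : ℤ)) := by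
  have hz : (z : ℂ) ≠ 0 := Circle.coe_ne_zero z
  simp only [mul_apply, conjTranspose_apply, fourierMatrix, of_apply, RCLike.star_def,
    apply_ite (starRingEnd ℂ), map_zero, conj_circle_zpow, neg_neg, ite_mul, zero_mul,
    mul_ite, mul_zero, Finset.sum_ite_eq', Finset.mem_univ, if_true]
  rw [sub_eq_add_neg, zpow_add₀ hz]
  ring

/-- Each phase `θ` gives an upper bound for the independence number of the `n`-th graph: by the
orthogonality of characters, the sum of the forms `F(z)` over the `n` nodes `z` is a Hermitian
matrix supported on the edges of the graph, hence zero on an independent set. -/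
theorem indepNum_le_sum_signedCount {D : Fin m → Fin m → Finset ℤ}
    {F : Matrix (Fin m) (Fin m) ℂ[T;T⁻¹]} (hF : IsSelfConjugate F) (hDF : Majorizes D F)
    {s : ℝ} (hs : s ≠ 0) {n : ℕ} (θ : ℝ)
    (hdet : ∀ j, (evalAt F (fourierNode n θ j)).det ≠ 0) :
    indepNum D n ≤ ∑ j, signedCount s (evalAt F (fourierNode n θ j)) := by
  classical
  obtain ⟨S, hS, hcard⟩ := exists_isIndep D n
  rw [← hcard, ← Fintype.card_coe S]
  refine card_le_sum_signedCount hs _ (fun j => isHermitian_evalAt hF _) hdet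
    (fun j => fourierMatrix S (fourierNode n θ j)) (fun x hx => ?_) ?_
  · -- Joint injectivity is Parseval's identity `∑ j, (E j)ᴴ * E j = n • 1`.
    have hpars : ∑ j, (fourierMatrix S (fourierNode n θ j))ᴴ *
        fourierMatrix S (fourierNode n θ j) = (n : ℂ) • (1 : Matrix S S ℂ) := by
      ext p q
      have hent : ∀ j, ((fourierMatrix S (fourierNode n θ j))ᴴ *
          fourierMatrix S (fourierNode n θ j)) p q = (1 : Matrix (Fin m) (Fin m) ℂ) p.1.1 q.1.1 *
          (fourierNode n θ j : ℂ) ^ (((p.1.2 : ℕ) : ℤ) - ((q.1.2 : ℕ) : ℤ)) := fun j => by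
        rw [← fourierMatrix_conj_apply, Matrix.mul_one]
      rw [Matrix.sum_apply, Finset.sum_congr rfl fun j _ => hent j, ← Finset.mul_sum,
        Matrix.smul_apply]
      by_cases hpq : p = q
      · subst hpq
        simp
      rw [one_apply_ne hpq, smul_zero]
      by_cases h1 : p.1.1 = q.1.1
      · rw [sum_fourierNode_zpow_eq_zero, mul_zero]
        intro hdvd
        apply hpq
        refine Subtype.ext (Prod.ext h1 (Fin.ext ?_))
        have := Int.eq_zero_of_abs_lt_dvd hdvd (by rw [abs_lt]; constructor <;> omega)
        omega
      · rw [one_apply_ne h1, zero_mul]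
    have h := congrArg (fun M => M *ᵥ x) hpars
    simp only [sum_mulVec, ← mulVec_mulVec, hx, mulVec_zero, Finset.sum_const_zero, smul_mulVec,
      one_mulVec] at h
    rcases smul_eq_zero.1 h.symm with h0 | h0
    · funext p
      have hp := p.1.2.isLt
      have : n = 0 := by exact_mod_cast h0
      omega
    · exact h0
  · ext p q
    rw [Matrix.sum_apply, Matrix.zero_apply]
    simp only [fourierMatrix_conj_apply, evalAt, map_apply, eval₂_toUnits_eq_sum, Finsupp.sum,
      Finset.sum_mul, mul_assoc, ← zpow_add₀ (Circle.coe_ne_zero _)]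
    rw [Finset.sum_comm]
    refine Finset.sum_eq_zero fun d hd => ?_
    rw [← Finset.mul_sum, sum_fourierNode_zpow_eq_zero, mul_zero]
    intro hdvd
    refine hS p.1 p.2 q.1 q.2 ⟨d, hDF _ _ hd, (Int.modEq_iff_dvd.2 ?_)⟩
    convert hdvd using 1
    ring

/-! ### Averaging over the phase -/

theorem intervalIntegrable_signedCount {F : Matrix (Fin m) (Fin m) ℂ[T;T⁻¹]}
    (hF : IsSelfConjugate F) (s a b : ℝ) :
    IntervalIntegrable (fun θ : ℝ => (signedCount s (evalAt F (Circle.exp θ)) : ℝ))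
      MeasureTheory.volume a b := by
  refine (intervalIntegrable_const (c := (m : ℝ))).mono_fun
    (measurable_signedCount s (fun θ => isHermitian_evalAt hF _)
      (continuous_evalAt_exp F)).aestronglyMeasurable (Eventually.of_forall fun θ => ?_)
  simpa using signedCount_le s (isHermitian_evalAt hF _)

theorem mul_indepNum_le_mul_integral {D : Fin m → Fin m → Finset ℤ}
    {F : Matrix (Fin m) (Fin m) ℂ[T;T⁻¹]} (hF : IsSelfConjugate F) (hdet : F.det ≠ 0)
    (hDF : Majorizes D F) {s : ℝ} (hs : s ≠ 0) (n : ℕ) :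
    2 * Real.pi * indepNum D n ≤
      n * ∫ θ in (0 : ℝ)..(2 * Real.pi), (signedCount s (evalAt F (Circle.exp θ)) : ℝ) := by
  let N : ℝ → ℝ := fun θ => (signedCount s (evalAt F (Circle.exp θ)) : ℝ)
  have hper : Function.Periodic N (2 * Real.pi) := fun θ => by
    simp only [N, Circle.exp_add_two_pi]
  have hint : ∀ c : ℝ, IntervalIntegrable (fun θ => N (θ + c)) MeasureTheory.volume
      0 (2 * Real.pi) := fun c => by
    have h : IntervalIntegrable N MeasureTheory.volume (0 + c) (2 * Real.pi + c) :=
      intervalIntegrable_signedCount hF s _ _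
    simpa only [add_sub_cancel_right] using h.comp_add_right c
  have hshift : ∀ c : ℝ, ∫ θ in (0 : ℝ)..(2 * Real.pi), N (θ + c) =
      ∫ θ in (0 : ℝ)..(2 * Real.pi), N θ := by
    intro c
    rw [intervalIntegral.integral_comp_add_right, zero_add, add_comm (2 * Real.pi) c,
      hper.intervalIntegral_add_eq c 0, zero_add]
  have hae : ∀ᵐ θ : ℝ, (indepNum D n : ℝ) ≤ ∑ j : Fin n, N (θ + 2 * Real.pi * j / n) := by
    have hall : ∀ᵐ θ : ℝ, ∀ j : Fin n, (evalAt F (fourierNode n θ j)).det ≠ 0 :=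
      MeasureTheory.ae_all_iff.2 fun j => ae_det_evalAt_exp_ne_zero hdet _
    filter_upwards [hall] with θ hθ
    have h := indepNum_le_sum_signedCount hF hDF hs θ hθ
    calc (indepNum D n : ℝ) ≤ _ := Nat.cast_le.2 h
      _ = _ := Nat.cast_sum _ _
  have hsum : IntervalIntegrable (fun θ => ∑ j : Fin n, N (θ + 2 * Real.pi * j / n))
      MeasureTheory.volume 0 (2 * Real.pi) := by
    simpa only [Finset.sum_fn] using IntervalIntegrable.sum Finset.univ
      (f := fun (j : Fin n) θ => N (θ + 2 * Real.pi * j / n)) fun j _ => hint _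
  calc 2 * Real.pi * indepNum D n
      = ∫ θ in (0 : ℝ)..(2 * Real.pi), (indepNum D n : ℝ) := by simp
    _ ≤ ∫ θ in (0 : ℝ)..(2 * Real.pi), ∑ j : Fin n, N (θ + 2 * Real.pi * j / n) :=
      intervalIntegral.integral_mono_ae Real.two_pi_pos.le intervalIntegrable_const
        hsum hae
    _ = ∑ j : Fin n, ∫ θ in (0 : ℝ)..(2 * Real.pi), N (θ + 2 * Real.pi * j / n) :=
      intervalIntegral.integral_finsetSum fun j _ => hint _
    _ = n * ∫ θ in (0 : ℝ)..(2 * Real.pi), N θ := by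
      simp [hshift]

theorem alpha_le_integral_signedCount (hm : 0 < m) {D : Fin m → Fin m → Finset ℤ}
    {F : Matrix (Fin m) (Fin m) ℂ[T;T⁻¹]} (hF : IsSelfConjugate F) (hdet : F.det ≠ 0)
    (hDF : Majorizes D F) {s : ℝ} (hs : s ≠ 0) :
    alpha D ≤ 1 / (2 * Real.pi * (m : ℝ)) *
      ∫ θ in (0 : ℝ)..(2 * Real.pi), (signedCount s (evalAt F (Circle.exp θ)) : ℝ) := by
  refine le_of_tendsto (tendsto_indepRatio D) ?_
  filter_upwards [eventually_gt_atTop 0] with n hn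
  have h := mul_indepNum_le_mul_integral hF hdet hDF hs n
  have hm' : (0 : ℝ) < m := by exact_mod_cast hm
  have hn' : (0 : ℝ) < n := by exact_mod_cast hn
  have hpi := Real.pi_pos
  rw [indepRatio, one_div_mul_eq_div, div_le_div_iff₀ (by positivity) (by positivity)]
  calc (indepNum D n : ℝ) * (2 * Real.pi * m) = 2 * Real.pi * indepNum D n * m := by ring
    _ ≤ _ := mul_le_mul_of_nonneg_right h hm'.le
    _ = _ := by ring

end BlockCirculant

theorem mainTheorem4 {m : ℕ} (hm : 0 < m) (D : Fin m → Fin m → Finset ℤ)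
    (hD : BlockCirculant.IsDifferenceMatrix D)
    (F : Matrix (Fin m) (Fin m) (LaurentPolynomial ℂ))
    (hF : BlockCirculant.IsSelfConjugate F)
    (hdet : F.det ≠ 0)
    (hDF : BlockCirculant.Majorizes D F) :
    Filter.Tendsto (BlockCirculant.indepRatio D) Filter.atTop (nhds (BlockCirculant.alpha D)) ∧
    IntervalIntegrable (fun θ : ℝ =>
      (BlockCirculant.numPos (BlockCirculant.evalAt F (Circle.exp θ)) : ℝ))
      MeasureTheory.volume 0 (2 * Real.pi) ∧
    IntervalIntegrable (fun θ : ℝ =>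
      (BlockCirculant.numNeg (BlockCirculant.evalAt F (Circle.exp θ)) : ℝ))
      MeasureTheory.volume 0 (2 * Real.pi) ∧
    BlockCirculant.alpha D ≤ min (BlockCirculant.rhoPos F) (BlockCirculant.rhoNeg F) := by
  have hH := fun θ : ℝ => BlockCirculant.isHermitian_evalAt hF (Circle.exp θ)
  simp only [BlockCirculant.rhoPos, BlockCirculant.rhoNeg,
    BlockCirculant.numPos_eq_signedCount (hH _), BlockCirculant.numNeg_eq_signedCount (hH _)]
  exact ⟨BlockCirculant.tendsto_indepRatio D,
    BlockCirculant.intervalIntegrable_signedCount hF 1 _ _,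
    BlockCirculant.intervalIntegrable_signedCount hF (-1) _ _,
    le_min (BlockCirculant.alpha_le_integral_signedCount hm hF hdet hDF one_ne_zero)
      (BlockCirculant.alpha_le_integral_signedCount hm hF hdet hDF (neg_ne_zero.2 one_ne_zero))⟩
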